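/- Let $\mathcal X,\mathcal Y$ be finite non-empty alphabets, let $W(y\,|\,x)$ be transition probabilities from $\mathcal X$ to $\mathcal Y$, and let $K>0$. All logarithms are natural. For a block length $n$, a rate $R\ge 0$ and a codebook $\mathcal C_n$ of $\lfloor e^{nR}\rfloor$ (not necessarily distinct) codewords $\mathbf x_m\in\mathcal X^n$, a channel instance is generated as follows: for each message $m$ a cloud of $\lfloor e^{nK}\rfloor$ sequences in $\mathcal Y^n$ is drawn, all sequences of all clouds being independent, with the $i$-th letter of a sequence in the cloud of $m$ distributed according to $W(\cdot\,|\,x_{m i})$, independently over $i$. The messages are equiprobable; when message $m$ is sent, the channel outputs one of the $\lfloor e^{nK}\rfloor$ (not necessarily distinct) sequences of the cloud of $m$, chosen uniformly. Let $P_e(\mathcal C_n)$ be the error probability of the maximum-likelihood decoder that knows the codebook and the channel instance (ties are broken uniformly at random), averaged over messages, channel instances and channel outputs. The capacity $C(W,K)$ of the channel ensemble is the supremum of the rates $R\ge 0$ for which there is a sequence of codebooks $\mathcal C_n$ of size $\lfloor e^{nR}\rfloor$ with $P_e(\mathcal C_n)\to 0$ as $n\to\infty$. Theorem (Ensemble capacity).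 This supremum is finite, and $$C(W,K)=\max\{\,C(W),\;H_{\max}(W)-K\,\},$$ where $C(W)=\max_P I(P,W)$ is the Shannon capacity of the discrete memoryless channel $W$, with $I(P,W)=\sum_{x,y}P(x)W(y\,|\,x)\log\frac{W(y\,|\,x)}{T(y)}$, and $H_{\max}(W)=\max_P\big\{-\sum_y T(y)\log T(y)\big\}$ is the maximal output entropy, with $T(y)=\sum_x P(x)W(y\,|\,x)$; both maxima are over all probability distributions $P$ on $\mathcal X$. -/

import Mathlib

noncomputable section

namespace CloudChannel

variable {X Y : Type*} [Fintype X] [Fintype Y]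

/-! ### Single-letter quantities (natural logarithms) -/

/-- `W x y = W(y | x)` is a matrix of transition probabilities. -/
def IsTransition (W : X → Y → ℝ) : Prop :=
  ∀ x, W x ∈ stdSimplex ℝ Y

/-- Output distribution `T(y) = ∑ x, P(x) W(y | x)`. -/
def outputDist (P : X → ℝ) (W : X → Y → ℝ) (y : Y) : ℝ :=
  ∑ x, P x * W x y

/-- Entropy `H_T = E_T[-log T(Y)]`. -/
def entropy (T : Y → ℝ) : ℝ :=
  ∑ y, T y * (-Real.log (T y))

/-- Mutual information of input and output under the joint distribution `P(x) W(y | x)`.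
A term with `P(x) W(y | x) = 0` is zero, and otherwise `T(y) > 0`. -/
def mutualInfo (P : X → ℝ) (W : X → Y → ℝ) : ℝ :=
  ∑ x, ∑ y, P x * W x y * Real.log (W x y / outputDist P W y)

/-- Shannon capacity `max_P I(P, W)` of the discrete memoryless channel `W`. -/
def shannonCapacity (W : X → Y → ℝ) : ℝ :=
  sSup ((fun P : X → ℝ => mutualInfo P W) '' stdSimplex ℝ X)

/-- Maximal output entropy `max_P H_T`, with `T` the output distribution of `P`. -/
def maxOutputEntropy (W : X → Y → ℝ) : ℝ :=
  sSup ((fun P : X → ℝ => entropy (outputDist P W)) '' stdSimplex ℝ X)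

/-! ### The maxima are attained -/

theorem continuous_outputDist (W : X → Y → ℝ) :
    Continuous fun P : X → ℝ => outputDist P W := by
  unfold outputDist
  fun_prop

theorem continuous_entropy : Continuous (entropy : (Y → ℝ) → ℝ) := by
  have h : (entropy : (Y → ℝ) → ℝ) = fun T => ∑ y, Real.negMulLog (T y) := by
    funext T
    simp [entropy, Real.negMulLog]
  rw [h]
  have := Real.continuous_negMulLog
  fun_prop

theorem mutualInfo_eq {W : X → Y → ℝ} (hW : IsTransition W) {P : X → ℝ}
    (hP : P ∈ stdSimplex ℝ X) :
    mutualInfo P W = entropy (outputDist P W) - ∑ x, P x * entropy (W x) := by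
  have hterm : ∀ x y, P x * W x y * Real.log (W x y / outputDist P W y)
      = P x * W x y * (-Real.log (outputDist P W y))
        - P x * (W x y * (-Real.log (W x y))) := by
    intro x y
    by_cases h0 : P x * W x y = 0
    · rw [h0, ← mul_assoc, h0]; simp
    · have hw : W x y ≠ 0 := right_ne_zero_of_mul h0
      have hT : 0 < outputDist P W y :=
        lt_of_lt_of_le (lt_of_le_of_ne (mul_nonneg (hP.1 x) ((hW x).1 y)) (Ne.symm h0))
          (Finset.single_le_sum (f := fun x => P x * W x y)
            (fun x _ => mul_nonneg (hP.1 x) ((hW x).1 y)) (Finset.mem_univ x))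
      rw [Real.log_div hw hT.ne']
      ring
  unfold mutualInfo
  simp_rw [hterm, Finset.sum_sub_distrib]
  congr 1
  · rw [Finset.sum_comm]
    simp [entropy, outputDist, Finset.sum_mul]
  · simp [entropy, Finset.mul_sum]

theorem isGreatest_shannonCapacity [Nonempty X] {W : X → Y → ℝ} (hW : IsTransition W) :
    IsGreatest ((fun P : X → ℝ => mutualInfo P W) '' stdSimplex ℝ X) (shannonCapacity W) := by
  classical
  refine IsCompact.isGreatest_sSup ?_ ?_
  · refine (isCompact_stdSimplex ℝ X).image_of_continuousOn ?_
    have h : Continuous fun P : X → ℝ =>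
        entropy (outputDist P W) - ∑ x, P x * entropy (W x) :=
      (continuous_entropy.comp (continuous_outputDist W)).sub (by fun_prop)
    exact h.continuousOn.congr fun P hP => mutualInfo_eq hW hP
  · exact ⟨_, ⟨_, single_mem_stdSimplex ℝ (Classical.arbitrary X), rfl⟩⟩

theorem isGreatest_maxOutputEntropy [Nonempty X] (W : X → Y → ℝ) :
    IsGreatest ((fun P : X → ℝ => entropy (outputDist P W)) '' stdSimplex ℝ X)
      (maxOutputEntropy W) := by
  classical
  refine IsCompact.isGreatest_sSup ?_ ?_
  · exact (isCompact_stdSimplex ℝ X).image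
      (continuous_entropy.comp (continuous_outputDist W))
  · exact ⟨_, ⟨_, single_mem_stdSimplex ℝ (Classical.arbitrary X), rfl⟩⟩

/-! ### The channel ensemble

`M` is the number of messages, `L` the number of sequences in each cloud, `n` the block length.
A codebook is a map `c : Fin M → Fin n → X` (codewords need not be distinct), and a channel
instance is a map `ω : Fin M → Fin L → Fin n → Y`: the cloud of message `m` consists of the
sequences `ω m l`, not necessarily distinct. -/

variable {M L n : ℕ}

/-- Probability of the channel instance `ω` for the codebook `c`: all letters of all sequences of
all clouds are independent, and letter `i` of each sequence in the cloud of `m` has the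
distribution `W(· | c m i)`. -/
def instanceProb (W : X → Y → ℝ) (c : Fin M → Fin n → X) (ω : Fin M → Fin L → Fin n → Y) : ℝ :=
  ∏ m, ∏ l, ∏ i, W (c m i) (ω m l i)

variable [DecidableEq Y]

/-- The channel action: given message `m`, the output is a uniformly chosen element of the cloud
of `m`, so `y` is received with probability (number of replicas of `y` in the cloud) / `L`. -/
def cloudLaw (ω : Fin M → Fin L → Fin n → Y) (m : Fin M) (y : Fin n → Y) : ℝ :=
  ((Finset.univ.filter fun l : Fin L => ω m l = y).card : ℝ) / (L : ℝ)

/-- The messages of maximal likelihood given the received vector `y` and the instance `ω`. -/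
def mlMessages (ω : Fin M → Fin L → Fin n → Y) (y : Fin n → Y) : Finset (Fin M) :=
  Finset.univ.filter fun m => ∀ m', cloudLaw ω m' y ≤ cloudLaw ω m y

/-- Probability that the maximum-likelihood decoder, which knows the codebook and the instance
and breaks ties uniformly at random, outputs `m` when `y` is received. -/
def mlDecode (ω : Fin M → Fin L → Fin n → Y) (y : Fin n → Y) (m : Fin M) : ℝ :=
  if m ∈ mlMessages ω y then 1 / ((mlMessages ω y).card : ℝ) else 0

/-- Error probability of the maximum-likelihood decoder for the instance `ω`, averaged over
equiprobable messages and the channel action. -/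
def instanceError (ω : Fin M → Fin L → Fin n → Y) : ℝ :=
  (1 / (M : ℝ)) * ∑ m, ∑ y, cloudLaw ω m y * (1 - mlDecode ω y m)

/-- `P_e` of the codebook `c` with clouds of size `L`: the error probability of the
maximum-likelihood decoder, averaged over messages and channel instances. -/
def avgError (W : X → Y → ℝ) (L : ℕ) (c : Fin M → Fin n → X) : ℝ :=
  ∑ ω : Fin M → Fin L → Fin n → Y, instanceProb W c ω * instanceError ω

/-- The rates `R ≥ 0` for which some sequence of codebooks of block length `n` and size
`⌊e^{nR}⌋`, used with clouds of size `⌊e^{nK}⌋`, has `P_e → 0`. -/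
def achievableRates (W : X → Y → ℝ) (K : ℝ) : Set ℝ :=
  {R | 0 ≤ R ∧ ∃ c : (n : ℕ) → Fin ⌊Real.exp (n * R)⌋₊ → Fin n → X,
    Filter.Tendsto (fun n : ℕ => avgError W ⌊Real.exp (n * K)⌋₊ (c n)) Filter.atTop (nhds 0)}

/-- Capacity `C(W, K)` of the channel ensemble: the supremum of the achievable rates. -/
def ensembleCapacity (W : X → Y → ℝ) (K : ℝ) : ℝ :=
  sSup (achievableRates W K)

end CloudChannel

end

/-! Write `N` for the number of replicas of `y` in a cloud of size `L`. Achievability is random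
coding with i.i.d. letters and two suboptimal decoders. Averaged over instances, a cloud acts as the
memoryless channel, so a threshold test on the information density that ignores the instance reaches
every rate below `I(P,W)` (`mem_achievableRates_of_lt_mutualInfo`). Alternatively, the decoder looks
for the only cloud that contains `y`: for typical `y` a wrong cloud contains it with probability at
most about `L * exp (-n H_T)`, so a union bound over messages reaches every rate below `H_T - K`
(`mem_achievableRates_of_lt_entropy`).

Converse: the success probability of an instance is `(1/M) ∑ y, max_m N_m(y) / L`. Sort codewords by
empirical distribution `P`. Up to a small probability, the output lies among about `exp (n H_T)`
typical sequences, each of conditional probability at most `w ≈ exp (-n ∑ P(a) H(W a))`. The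
inequality `N ≤ θ + N² / θ` with `θ` slightly above `1 + L w` splits the maximum: the second moment
makes the last term negligible, while the first contributes about `exp (n H_T) * (1/L + w)`, that is
`exp (n (H_T - K)) + exp (n I(P,W))`. There are polynomially many classes, so after division by `M`
success vanishes above the claimed capacity (`one_sub_avgError_le`, `one_sub_avgError_le_of_size`).
-/

noncomputable section

namespace CloudChannel

/-! ### Finite product distributions -/

section Product

variable {ι U : Type*} [Fintype ι]

/-- The product of the weights `q i` at the point `u`. -/
def piWeight (q : ι → U → ℝ) (u : ι → U) : ℝ := ∏ i, q i (u i)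

theorem piWeight_nonneg {q : ι → U → ℝ} (hq : ∀ i a, 0 ≤ q i a) (u : ι → U) :
    0 ≤ piWeight q u :=
  Finset.prod_nonneg fun i _ => hq i _

variable [DecidableEq ι] [Fintype U]

/-- Independence in the form of distributivity; the one- and two-coordinate expectations below take
factors equal to `1` elsewhere. -/
theorem sum_piWeight_mul_prod (q h : ι → U → ℝ) :
    ∑ u, piWeight q u * ∏ i, h i (u i) = ∏ i, ∑ a, q i a * h i a := by
  simp only [piWeight, ← Finset.prod_mul_distrib]
  rw [Finset.prod_univ_sum, Fintype.piFinset_univ]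

theorem sum_piWeight {q : ι → U → ℝ} (hq : ∀ i, ∑ a, q i a = 1) : ∑ u, piWeight q u = 1 := by
  simpa [hq] using sum_piWeight_mul_prod q fun _ _ => 1

theorem sum_piWeight_single {q : ι → U → ℝ} (hq : ∀ i, ∑ a, q i a = 1) (j : ι) (f : U → ℝ) :
    ∑ u, piWeight q u * f (u j) = ∑ a, q j a * f a := by
  have h := sum_piWeight_mul_prod q fun i a => if i = j then f a else 1
  simp only [Finset.prod_ite_eq', Finset.mem_univ, if_true] at h
  rw [h, Finset.prod_eq_single j]
  · simp
  · intro i _ hi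
    simp [hi, hq]
  · simp

theorem sum_piWeight_pair {q : ι → U → ℝ} (hq : ∀ i, ∑ a, q i a = 1) {j k : ι} (hjk : j ≠ k)
    (f g : U → ℝ) :
    ∑ u, piWeight q u * (f (u j) * g (u k)) = (∑ a, q j a * f a) * ∑ a, q k a * g a := by
  have h := sum_piWeight_mul_prod q
    fun i a => (if i = j then f a else 1) * (if i = k then g a else 1)
  simp only [Finset.prod_mul_distrib, Finset.prod_ite_eq', Finset.mem_univ, if_true] at h
  rw [h, Finset.prod_eq_mul j k hjk]
  · simp [hjk, hjk.symm]
  · rintro i _ ⟨hi, hi'⟩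
    simp [hi, hi', hq]
  · simp
  · simp

/-- After expanding the square, the cross terms vanish because the summands are independent and
centred. -/
theorem sum_piWeight_mul_sum_sq {q : ι → U → ℝ} (hq : ∀ i, ∑ a, q i a = 1) (g : ι → U → ℝ)
    (hg : ∀ i, ∑ a, q i a * g i a = 0) :
    ∑ u, piWeight q u * (∑ i, g i (u i)) ^ 2 = ∑ i, ∑ a, q i a * g i a ^ 2 := by
  have h : ∀ u, piWeight q u * (∑ i, g i (u i)) ^ 2
      = ∑ i, ∑ j, piWeight q u * (g i (u i) * g j (u j)) := by
    intro u
    rw [sq, Finset.sum_mul_sum, Finset.mul_sum]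
    simp_rw [Finset.mul_sum]
  simp_rw [h]
  rw [Finset.sum_comm]
  refine Finset.sum_congr rfl fun i _ => ?_
  rw [Finset.sum_comm, Finset.sum_eq_single i]
  · rw [← sum_piWeight_single hq i fun a => g i a ^ 2]
    simp [sq]
  · intro j _ hj
    rw [sum_piWeight_pair hq hj.symm, hg, zero_mul]
  · simp

/-- Chebyshev's inequality for a sum of independent, not necessarily identically distributed,
finitely valued variables, with the variances bounded by the second moments. -/
theorem sum_piWeight_le_chebyshev {q : ι → U → ℝ} (hq0 : ∀ i a, 0 ≤ q i a)
    (hq : ∀ i, ∑ a, q i a = 1) (f : ι → U → ℝ) {t : ℝ} (ht : 0 < t) (φ : (ι → U) → ℝ)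
    (hφ1 : ∀ u, φ u ≤ 1)
    (hφ : ∀ u, piWeight q u ≠ 0 →
      |∑ i, f i (u i) - ∑ i, ∑ a, q i a * f i a| < t → φ u ≤ 0) :
    ∑ u, piWeight q u * φ u ≤ (∑ i, ∑ a, q i a * f i a ^ 2) / t ^ 2 := by
  set μ : ι → ℝ := fun i => ∑ a, q i a * f i a with hμ
  have hg : ∀ i, ∑ a, q i a * (f i a - μ i) = 0 := by
    intro i
    simp only [mul_sub, Finset.sum_sub_distrib, ← Finset.sum_mul, hq, one_mul, hμ, sub_self]
  have hvar : ∀ i, ∑ a, q i a * (f i a - μ i) ^ 2 ≤ ∑ a, q i a * f i a ^ 2 := by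
    intro i
    have : ∑ a, q i a * (f i a - μ i) ^ 2 = ∑ a, q i a * f i a ^ 2 - μ i ^ 2 := by
      have h1 : ∀ a, q i a * (f i a - μ i) ^ 2
          = q i a * f i a ^ 2 - 2 * μ i * (q i a * f i a) + μ i ^ 2 * q i a := fun a => by ring
      simp_rw [h1, Finset.sum_add_distrib, Finset.sum_sub_distrib, ← Finset.mul_sum, hq]
      change _ - 2 * μ i * μ i + _ = _
      ring
    rw [this]
    linarith [sq_nonneg (μ i)]
  rw [le_div_iff₀ (by positivity), Finset.sum_mul]
  calc ∑ u, piWeight q u * φ u * t ^ 2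
      ≤ ∑ u, piWeight q u * (∑ i, (f i (u i) - μ i)) ^ 2 := by
        refine Finset.sum_le_sum fun u _ => ?_
        rw [mul_assoc]
        by_cases h0 : piWeight q u = 0
        · simp [h0]
        refine mul_le_mul_of_nonneg_left ?_ (piWeight_nonneg hq0 u)
        -- Pointwise, `φ u * t ^ 2` is at most the squared deviation: it is nonpositive below `t`,
        -- and `φ u ≤ 1` suffices otherwise.
        by_cases hlt : |∑ i, f i (u i) - ∑ i, μ i| < t
        · nlinarith [hφ u h0 hlt, sq_nonneg t, sq_nonneg (∑ i, (f i (u i) - μ i))]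
        · rw [Finset.sum_sub_distrib, ← sq_abs (_ - _)]
          push Not at hlt
          nlinarith [hφ1 u, sq_nonneg t]
    _ = ∑ i, ∑ a, q i a * (f i a - μ i) ^ 2 :=
        sum_piWeight_mul_sum_sq hq (fun i a => f i a - μ i) hg
    _ ≤ _ := Finset.sum_le_sum fun i _ => hvar i

end Product

/-! ### Clouds and maximum-likelihood decoding -/

section Decoding

variable {X Y : Type*} {M L n : ℕ}

/-- The law `W(y | x)` of the memoryless channel for blocks of length `n`. -/
def channelLaw (W : X → Y → ℝ) (x : Fin n → X) : (Fin n → Y) → ℝ :=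
  piWeight fun i => W (x i)

/-- The law of a cloud of `L` sequences generated by the codeword `x`. -/
def cloudWeight (W : X → Y → ℝ) (L : ℕ) (x : Fin n → X) : (Fin L → Fin n → Y) → ℝ :=
  piWeight fun _ => channelLaw W x

variable [Fintype Y]

theorem channelLaw_nonneg {W : X → Y → ℝ} (hW : IsTransition W) (x : Fin n → X) (y : Fin n → Y) :
    0 ≤ channelLaw W x y :=
  piWeight_nonneg (fun i => (hW (x i)).1) y

theorem sum_channelLaw {W : X → Y → ℝ} (hW : IsTransition W) (x : Fin n → X) :
    ∑ y, channelLaw W x y = 1 :=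
  sum_piWeight fun i => (hW (x i)).2

theorem cloudWeight_nonneg {W : X → Y → ℝ} (hW : IsTransition W) (x : Fin n → X)
    (v : Fin L → Fin n → Y) : 0 ≤ cloudWeight W L x v :=
  piWeight_nonneg (fun _ => channelLaw_nonneg hW x) v

theorem sum_cloudWeight {W : X → Y → ℝ} (hW : IsTransition W) (L : ℕ) (x : Fin n → X) :
    ∑ v, cloudWeight W L x v = 1 :=
  sum_piWeight fun _ => sum_channelLaw hW x

theorem instanceProb_nonneg {W : X → Y → ℝ} (hW : IsTransition W) (c : Fin M → Fin n → X)
    (ω : Fin M → Fin L → Fin n → Y) : 0 ≤ instanceProb W c ω :=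
  piWeight_nonneg (fun m => cloudWeight_nonneg hW (c m)) ω

theorem sum_instanceProb {W : X → Y → ℝ} (hW : IsTransition W) (c : Fin M → Fin n → X) :
    ∑ ω : Fin M → Fin L → Fin n → Y, instanceProb W c ω = 1 :=
  sum_piWeight fun m => sum_cloudWeight hW L (c m)

variable [DecidableEq Y]

/-- The number of replicas of `y` in the cloud `v`. -/
def replicas (v : Fin L → Fin n → Y) (y : Fin n → Y) : ℝ := ∑ l, if v l = y then 1 else 0

omit [Fintype Y] in
theorem replicas_nonneg (v : Fin L → Fin n → Y) (y : Fin n → Y) : 0 ≤ replicas v y :=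
  Finset.sum_nonneg fun _ _ => by positivity

omit [Fintype Y] in
theorem cloudLaw_eq (ω : Fin M → Fin L → Fin n → Y) (m : Fin M) (y : Fin n → Y) :
    cloudLaw ω m y = replicas (ω m) y / L := by
  simp [cloudLaw, replicas]

omit [Fintype Y] in
theorem cloudLaw_nonneg (ω : Fin M → Fin L → Fin n → Y) (m : Fin M) (y : Fin n → Y) :
    0 ≤ cloudLaw ω m y := by
  unfold cloudLaw; positivity

theorem sum_replicas (v : Fin L → Fin n → Y) : ∑ y, replicas v y = L := by
  simp only [replicas]
  rw [Finset.sum_comm]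
  simp

theorem sum_cloudLaw (hL : 0 < L) (ω : Fin M → Fin L → Fin n → Y) (m : Fin M) :
    ∑ y, cloudLaw ω m y = 1 := by
  simp only [cloudLaw_eq, ← Finset.sum_div, sum_replicas]
  exact div_self (by positivity)

theorem sum_cloudWeight_mul_replicas {W : X → Y → ℝ} (hW : IsTransition W) (x : Fin n → X)
    (y : Fin n → Y) :
    ∑ v : Fin L → Fin n → Y, cloudWeight W L x v * replicas v y = L * channelLaw W x y := by
  simp only [replicas, Finset.mul_sum]
  rw [Finset.sum_comm]
  have h : ∀ l : Fin L, ∑ v : Fin L → Fin n → Y, cloudWeight W L x v * (if v l = y then 1 else 0)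
      = channelLaw W x y := fun l =>
    (sum_piWeight_single (fun _ => sum_channelLaw hW x) l fun z => if z = y then 1 else 0).trans
      (by simp)
  simp_rw [h]
  simp

/-- The replica count is binomial with parameters `L` and `p = channelLaw W x y`. Diagonal pairs
contribute `L p`; the off-diagonal ones contribute at most `L² p²`. -/
theorem sum_cloudWeight_mul_replicas_sq_le {W : X → Y → ℝ} (hW : IsTransition W) (x : Fin n → X)
    (y : Fin n → Y) :
    ∑ v : Fin L → Fin n → Y, cloudWeight W L x v * replicas v y ^ 2
      ≤ L * channelLaw W x y * (1 + L * channelLaw W x y) := by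
  have hp := channelLaw_nonneg hW x y
  simp only [replicas, sq, Finset.sum_mul_sum]
  simp_rw [Finset.mul_sum]
  rw [Finset.sum_comm]
  have h : ∀ k : Fin L, ∑ v : Fin L → Fin n → Y, ∑ l : Fin L,
      cloudWeight W L x v * ((if v k = y then 1 else 0) * (if v l = y then 1 else 0))
      ≤ channelLaw W x y * (1 + L * channelLaw W x y) := by
    intro k
    rw [Finset.sum_comm]
    have hl : ∀ l : Fin L, ∑ v : Fin L → Fin n → Y,
        cloudWeight W L x v * ((if v k = y then 1 else 0) * (if v l = y then 1 else 0))
        ≤ (if l = k then channelLaw W x y else 0) + channelLaw W x y * channelLaw W x y := by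
      intro l
      by_cases hlk : l = k
      · subst hlk
        have := (sum_piWeight_single (fun _ : Fin L => sum_channelLaw hW x) l
          fun z => if z = y then 1 else 0)
        simp only [mul_ite, mul_one, mul_zero, Finset.sum_ite_eq', Finset.mem_univ, if_true]
          at this
        simp only [mul_ite, mul_one, mul_zero, if_true]
        have h2 : ∀ v : Fin L → Fin n → Y, (if v l = y then if v l = y then cloudWeight W L x v
            else 0 else 0) = if v l = y then cloudWeight W L x v else 0 := by
          intro v; split_ifs <;> rfl
        simp only [h2]
        rw [cloudWeight, this]
        nlinarith
      · have := (sum_piWeight_pair (fun _ : Fin L => sum_channelLaw hW x) (Ne.symm hlk)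
          (fun z => if z = y then 1 else 0) fun z => if z = y then 1 else 0)
        rw [cloudWeight, this]
        simp [hlk]
    refine (Finset.sum_le_sum fun l _ => hl l).trans (le_of_eq ?_)
    simp [Finset.sum_add_distrib]
    ring
  refine (Finset.sum_le_sum fun k _ => h k).trans (le_of_eq ?_)
  simp
  ring

-- All tied messages have the same likelihood, so uniform tie-breaking averages equal numbers and
-- yields the maximum.
omit [Fintype Y] in
theorem exists_sum_mlDecode_eq (hM : 0 < M) (ω : Fin M → Fin L → Fin n → Y) (y : Fin n → Y) :
    ∃ m₀, (∀ m, cloudLaw ω m y ≤ cloudLaw ω m₀ y) ∧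
      ∑ m, cloudLaw ω m y * mlDecode ω y m = cloudLaw ω m₀ y := by
  have : Nonempty (Fin M) := ⟨⟨0, hM⟩⟩
  obtain ⟨m₀, hm₀⟩ := Finite.exists_max fun m => cloudLaw ω m y
  refine ⟨m₀, hm₀, ?_⟩
  have hmem : m₀ ∈ mlMessages ω y := by simp [mlMessages, hm₀]
  have hcard : ((mlMessages ω y).card : ℝ) ≠ 0 := by
    exact_mod_cast (Finset.card_pos.2 ⟨m₀, hmem⟩).ne'
  have hterm : ∀ m, cloudLaw ω m y * mlDecode ω y m
      = if m ∈ mlMessages ω y then cloudLaw ω m₀ y * (1 / ((mlMessages ω y).card : ℝ)) else 0 := by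
    intro m
    unfold mlDecode
    split_ifs with h
    · have : cloudLaw ω m₀ y ≤ cloudLaw ω m y := (Finset.mem_filter.1 h).2 m₀
      rw [le_antisymm (hm₀ m) this]
    · simp
  simp_rw [hterm]
  rw [Finset.sum_ite_mem, Finset.univ_inter, Finset.sum_const, nsmul_eq_mul]
  field_simp

theorem exists_instanceError_eq (hM : 0 < M) (hL : 0 < L) (ω : Fin M → Fin L → Fin n → Y) :
    ∃ m₀ : (Fin n → Y) → Fin M, (∀ y m, cloudLaw ω m y ≤ cloudLaw ω (m₀ y) y) ∧
      instanceError ω = 1 - (1 / (M : ℝ)) * ∑ y, cloudLaw ω (m₀ y) y := by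
  choose m₀ h1 h2 using exists_sum_mlDecode_eq hM ω
  refine ⟨m₀, h1, ?_⟩
  have hM' : (M : ℝ) ≠ 0 := by positivity
  have h3 : ∑ m, ∑ y, cloudLaw ω m y * (1 - mlDecode ω y m)
      = M - ∑ y, cloudLaw ω (m₀ y) y := by
    simp_rw [mul_sub, mul_one, Finset.sum_sub_distrib, sum_cloudLaw hL]
    rw [Finset.sum_comm]
    simp [h2]
  rw [instanceError, h3]
  field_simp

/-- The maximum-likelihood decoder is at least as good as the one that looks for the unique
message `m` with `A m y = 1`. -/
theorem instanceError_le (hM : 0 < M) (hL : 0 < L) (ω : Fin M → Fin L → Fin n → Y)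
    (A : Fin M → (Fin n → Y) → ℝ) (hA : ∀ m y, A m y = 0 ∨ A m y = 1) :
    instanceError ω ≤ (1 / (M : ℝ)) * ∑ m, ∑ y, cloudLaw ω m y *
      ((1 - A m y) + ∑ m' ∈ Finset.univ.erase m, A m' y) := by
  obtain ⟨m₀, h1, h2⟩ := exists_instanceError_eq hM hL ω
  have hM' : (0 : ℝ) < M := by positivity
  have hA0 : ∀ m y, 0 ≤ A m y := fun m y => by rcases hA m y with h | h <;> simp [h]
  have key : ∀ y, ∑ m, cloudLaw ω m y * (A m y - ∑ m' ∈ Finset.univ.erase m, A m' y)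
      ≤ cloudLaw ω (m₀ y) y := by
    intro y
    -- If another message is accepted, the bracket is nonpositive. Hence at most one term of the sum
    -- is positive, and it is bounded by the maximal likelihood.
    have hneg : ∀ m m', m' ≠ m → A m' y = 1 →
        cloudLaw ω m y * (A m y - ∑ m' ∈ Finset.univ.erase m, A m' y) ≤ 0 := by
      intro m m' hne h
      refine mul_nonpos_of_nonneg_of_nonpos (cloudLaw_nonneg ω m y) ?_
      have := Finset.single_le_sum (f := fun m' => A m' y) (s := Finset.univ.erase m)
        (fun k _ => hA0 k y) (Finset.mem_erase.2 ⟨hne, Finset.mem_univ m'⟩)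
      rcases hA m y with h' | h' <;> simp only [h, h'] at * <;> linarith
    by_cases hex : ∃ k, A k y = 1
    · obtain ⟨k, hk⟩ := hex
      refine (Finset.sum_le_sum (g := fun m => if m = k then cloudLaw ω k y else 0)
        fun m _ => ?_).trans ?_
      · by_cases hmk : m = k
        · subst hmk
          have := Finset.sum_nonneg (s := Finset.univ.erase m) fun m' _ => hA0 m' y
          simp only [if_true, hk]
          nlinarith [cloudLaw_nonneg ω m y]
        · simpa [hmk] using hneg m k (Ne.symm hmk) hk
      · simpa using h1 y k
    · push Not at hex
      have : ∀ m, A m y = 0 := fun m => (hA m y).resolve_right (hex m)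
      simpa [this] using cloudLaw_nonneg ω (m₀ y) y
  have h3 : ∑ m, ∑ y, cloudLaw ω m y *
      ((1 - A m y) + ∑ m' ∈ Finset.univ.erase m, A m' y)
      = M - ∑ y, ∑ m, cloudLaw ω m y * (A m y - ∑ m' ∈ Finset.univ.erase m, A m' y) := by
    rw [Finset.sum_comm (s := Finset.univ (α := Fin n → Y))]
    rw [eq_sub_iff_add_eq, ← Finset.sum_add_distrib]
    simp_rw [← Finset.sum_add_distrib, ← mul_add]
    simp [sum_cloudLaw hL]
  rw [h2, h3, mul_sub, one_div, inv_mul_cancel₀ hM'.ne']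
  gcongr
  exact key _

end Decoding

/-! ### Random coding -/

section RandomCoding

variable {X Y : Type*} [Fintype X] [Fintype Y] {M L n : ℕ}

theorem outputDist_mem_stdSimplex {W : X → Y → ℝ} (hW : IsTransition W) {P : X → ℝ}
    (hP : P ∈ stdSimplex ℝ X) : outputDist P W ∈ stdSimplex ℝ Y := by
  refine ⟨fun y => Finset.sum_nonneg fun x _ => mul_nonneg (hP.1 x) ((hW x).1 y), ?_⟩
  simp only [outputDist]
  rw [Finset.sum_comm]
  simp_rw [← Finset.mul_sum, (hW _).2, mul_one, hP.2]

omit [Fintype Y] in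
theorem sum_piWeight_mul_channelLaw (P : X → ℝ) (W : X → Y → ℝ) (y : Fin n → Y) :
    ∑ x : Fin n → X, piWeight (fun _ => P) x * channelLaw W x y
      = piWeight (fun _ => outputDist P W) y :=
  sum_piWeight_mul_prod (fun _ => P) fun i x => W x (y i)

/-- The common shape of the union bound, averaged twice: over the independent clouds of an instance,
then over the independent codewords of a random codebook. -/
theorem sum_piWeight_mul_pair_sum {ι κ U : Type*} [Fintype ι] [DecidableEq ι] [Fintype κ]
    [Fintype U] {q : ι → U → ℝ} (hq : ∀ i, ∑ a, q i a = 1) (r : ℝ) (f : ι → U → ℝ)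
    (g h : ι → κ → U → ℝ) :
    ∑ u, piWeight q u * (r * ∑ i, (f i (u i)
        + ∑ j ∈ Finset.univ.erase i, ∑ k, g i k (u i) * h j k (u j)))
      = r * ∑ i, ((∑ a, q i a * f i a) + ∑ j ∈ Finset.univ.erase i, ∑ k,
          (∑ a, q i a * g i k a) * ∑ a, q j a * h j k a) := by
  have h1 : ∀ u, piWeight q u * (r * ∑ i, (f i (u i)
        + ∑ j ∈ Finset.univ.erase i, ∑ k, g i k (u i) * h j k (u j)))
      = r * ∑ i, (piWeight q u * f i (u i)
        + ∑ j ∈ Finset.univ.erase i, ∑ k, piWeight q u * (g i k (u i) * h j k (u j))) := by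
    intro u
    rw [mul_left_comm, Finset.mul_sum]
    simp_rw [mul_add, Finset.mul_sum]
  simp_rw [h1]
  rw [← Finset.mul_sum, Finset.sum_comm]
  congr 1
  refine Finset.sum_congr rfl fun i _ => ?_
  rw [Finset.sum_add_distrib, sum_piWeight_single hq i (f i), Finset.sum_comm]
  congr 1
  refine Finset.sum_congr rfl fun j hj => ?_
  rw [Finset.sum_comm]
  exact Finset.sum_congr rfl fun k _ =>
    sum_piWeight_pair hq (Finset.ne_of_mem_erase hj).symm (g i k) (h j k)

variable [DecidableEq Y]

omit [Fintype X] in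
theorem avgError_nonneg {W : X → Y → ℝ} (hW : IsTransition W) (L : ℕ) (c : Fin M → Fin n → X) :
    0 ≤ avgError W L c := by
  refine Finset.sum_nonneg fun ω _ => mul_nonneg (instanceProb_nonneg hW c ω) ?_
  refine mul_nonneg (by positivity) (Finset.sum_nonneg fun m _ => Finset.sum_nonneg fun y _ =>
    mul_nonneg (cloudLaw_nonneg ω m y) ?_)
  unfold mlDecode
  split_ifs with h
  · have : (1 : ℝ) ≤ (mlMessages ω y).card := by
      exact_mod_cast Finset.card_pos.2 ⟨m, h⟩
    rw [sub_nonneg, div_le_one (by positivity)]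
    exact this
  · simp

-- A wrong cloud is independent of the transmitted one, so in the false-acceptance term the sent
-- cloud can be averaged separately and becomes `channelLaw`.
omit [Fintype X] in
theorem avgError_le {W : X → Y → ℝ} (hW : IsTransition W) (hM : 0 < M) (hL : 0 < L)
    (A : (Fin n → X) → (Fin L → Fin n → Y) → (Fin n → Y) → ℝ)
    (hA : ∀ x v y, A x v y = 0 ∨ A x v y = 1) (c : Fin M → Fin n → X) :
    avgError W L c ≤ (1 / (M : ℝ)) * ∑ m,
      ((∑ v, cloudWeight W L (c m) v * ∑ y, replicas v y / L * (1 - A (c m) v y))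
        + ∑ m' ∈ Finset.univ.erase m, ∑ y, channelLaw W (c m) y *
            ∑ v, cloudWeight W L (c m') v * A (c m') v y) := by
  have hL' : (L : ℝ) ≠ 0 := by positivity
  calc avgError W L c
      ≤ ∑ ω : Fin M → Fin L → Fin n → Y, instanceProb W c ω * ((1 / (M : ℝ)) * ∑ m,
        ((∑ y, replicas (ω m) y / L * (1 - A (c m) (ω m) y))
          + ∑ m' ∈ Finset.univ.erase m, ∑ y, replicas (ω m) y / L * A (c m') (ω m') y)) := by
        refine Finset.sum_le_sum fun ω _ => mul_le_mul_of_nonneg_left ?_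
          (instanceProb_nonneg hW c ω)
        refine (instanceError_le hM hL ω (fun m y => A (c m) (ω m) y) fun m y => hA _ _ _).trans
          (le_of_eq ?_)
        congr 1
        refine Finset.sum_congr rfl fun m _ => ?_
        simp_rw [mul_add, Finset.sum_add_distrib, cloudLaw_eq, Finset.mul_sum]
        congr 1
        rw [Finset.sum_comm]
    _ = _ := by
        have h := sum_piWeight_mul_pair_sum (κ := Fin n → Y)
          (fun m => sum_cloudWeight hW L (c m)) (1 / (M : ℝ))
          (fun m v => ∑ y, replicas v y / L * (1 - A (c m) v y))
          (fun _ y v => replicas v y / L) fun m y v => A (c m) v y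
        refine h.trans ?_
        simp_rw [← mul_div_assoc, ← Finset.sum_div, sum_cloudWeight_mul_replicas hW,
          mul_div_cancel_left₀ _ hL']

/-- Random coding with independent letters of distribution `P`. -/
theorem exists_avgError_le {W : X → Y → ℝ} (hW : IsTransition W) {P : X → ℝ}
    (hP : P ∈ stdSimplex ℝ X) (hM : 0 < M) (hL : 0 < L)
    (A : (Fin n → X) → (Fin L → Fin n → Y) → (Fin n → Y) → ℝ)
    (hA : ∀ x v y, A x v y = 0 ∨ A x v y = 1) :
    ∃ c : Fin M → Fin n → X, avgError W L c ≤
      (∑ x, piWeight (fun _ => P) x *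
        ∑ v, cloudWeight W L x v * ∑ y, replicas v y / L * (1 - A x v y))
      + M * ∑ y, piWeight (fun _ => outputDist P W) y *
          ∑ x, piWeight (fun _ => P) x * ∑ v, cloudWeight W L x v * A x v y := by
  have hM' : (0 : ℝ) < M := by positivity
  set p : (Fin n → X) → ℝ := piWeight fun _ => P with hp
  have hp0 : ∀ x, 0 ≤ p x := piWeight_nonneg fun _ => hP.1
  have hp1 : ∑ x, p x = 1 := sum_piWeight fun _ => hP.2
  have hA0 : ∀ x v y, 0 ≤ A x v y := fun x v y => by rcases hA x v y with h | h <;> simp [h]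
  set E₁ : (Fin n → X) → ℝ :=
    fun x => ∑ v, cloudWeight W L x v * ∑ y, replicas v y / L * (1 - A x v y) with hE₁
  set a : (Fin n → X) → (Fin n → Y) → ℝ := fun x y => ∑ v, cloudWeight W L x v * A x v y with ha
  have ha0 : ∀ x y, 0 ≤ a x y := fun x y => Finset.sum_nonneg fun v _ =>
    mul_nonneg (cloudWeight_nonneg hW x v) (hA0 x v y)
  set B := (∑ x, p x * E₁ x)
    + M * ∑ y, piWeight (fun _ => outputDist P W) y * ∑ x, p x * a x y with hB
  have hE₂ : 0 ≤ ∑ y : Fin n → Y, piWeight (fun _ => outputDist P W) y * ∑ x, p x * a x y :=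
    Finset.sum_nonneg fun y _ => mul_nonneg
      (piWeight_nonneg (fun _ => (outputDist_mem_stdSimplex hW hP).1) y)
      (Finset.sum_nonneg fun x _ => mul_nonneg (hp0 x) (ha0 x y))
  have havg : ∑ c : Fin M → Fin n → X, piWeight (fun _ => p) c * avgError W L c ≤ B := by
    calc _ ≤ ∑ c : Fin M → Fin n → X, piWeight (fun _ => p) c * ((1 / (M : ℝ)) * ∑ m,
            (E₁ (c m) + ∑ m' ∈ Finset.univ.erase m, ∑ y, channelLaw W (c m) y * a (c m') y)) :=
          Finset.sum_le_sum fun c _ => mul_le_mul_of_nonneg_left (avgError_le hW hM hL A hA c)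
            (piWeight_nonneg (fun _ => hp0) c)
      _ = (1 / (M : ℝ)) * ∑ m : Fin M, ((∑ x, p x * E₁ x) +
            ∑ m' ∈ Finset.univ.erase m, ∑ y, piWeight (fun _ => outputDist P W) y *
              ∑ x, p x * a x y) := by
          have h := sum_piWeight_mul_pair_sum (κ := Fin n → Y) (fun _ : Fin M => hp1)
            (1 / (M : ℝ)) (fun _ => E₁) (fun _ y x => channelLaw W x y) fun _ y x => a x y
          refine h.trans ?_
          simp_rw [hp, sum_piWeight_mul_channelLaw]
      _ ≤ (1 / (M : ℝ)) * ∑ m : Fin M, B := by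
          gcongr with m
          simp only [Finset.sum_const, nsmul_eq_mul, hB]
          gcongr
          exact_mod_cast (Finset.card_le_univ _).trans (by simp)
      _ = B := by
          simp only [Finset.sum_const, Finset.card_univ, Fintype.card_fin, nsmul_eq_mul]
          field_simp
  -- If every codebook exceeded `B`, so would the mean; strictness needs a codebook of positive
  -- weight.
  by_contra! hcon
  have hw1 : ∑ c : Fin M → Fin n → X, piWeight (fun _ => p) c = 1 := sum_piWeight fun _ => hp1
  have hlt : ∑ c : Fin M → Fin n → X, piWeight (fun _ => p) c * B
      < ∑ c : Fin M → Fin n → X, piWeight (fun _ => p) c * avgError W L c := by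
    have hw0 := fun c : Fin M → Fin n → X => piWeight_nonneg (fun _ : Fin M => hp0) c
    obtain ⟨c, -, hc⟩ := Finset.exists_ne_zero_of_sum_ne_zero (hw1.trans_ne one_ne_zero)
    exact Finset.sum_lt_sum (fun c _ => mul_le_mul_of_nonneg_left (hcon c).le (hw0 c))
      ⟨c, Finset.mem_univ c, mul_lt_mul_of_pos_left (hcon c) (lt_of_le_of_ne (hw0 c) hc.symm)⟩
  rw [← Finset.sum_mul, hw1, one_mul] at hlt
  exact absurd havg (not_le.2 hlt)

end RandomCoding

/-! ### Achievability -/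

section Achievability

variable {X Y : Type*} [Fintype X] [Fintype Y] {L n : ℕ}

theorem piWeight_eq_exp {ι U : Type*} [Fintype ι] {q : ι → U → ℝ} (hq : ∀ i a, 0 ≤ q i a)
    {u : ι → U} (hu : piWeight q u ≠ 0) : piWeight q u = Real.exp (∑ i, Real.log (q i (u i))) := by
  rw [Real.exp_sum, piWeight]
  refine Finset.prod_congr rfl fun i _ => (Real.exp_log ?_).symm
  exact lt_of_le_of_ne (hq i _) (Finset.prod_ne_zero_iff.1 hu i (Finset.mem_univ i)).symm

theorem floor_exp_pos {R : ℝ} (hR : 0 ≤ R) (n : ℕ) : 0 < ⌊Real.exp (n * R)⌋₊ :=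
  Nat.floor_pos.2 (Real.one_le_exp (by positivity))

theorem tendsto_exp_nat_mul_of_neg {a : ℝ} (ha : a < 0) :
    Filter.Tendsto (fun n : ℕ => Real.exp (n * a)) Filter.atTop (nhds 0) :=
  Real.tendsto_exp_atBot.comp (tendsto_natCast_atTop_atTop.atTop_mul_const_of_neg ha)

theorem sum_arrow_prod (F : (Fin n → X) → (Fin n → Y) → ℝ) :
    ∑ u : Fin n → X × Y, F (fun i => (u i).1) (fun i => (u i).2) = ∑ x, ∑ y, F x y := by
  rw [← Fintype.sum_prod_type']
  exact Fintype.sum_equiv (Equiv.arrowProdEquivProdArrow (Fin n) (fun _ => X) (fun _ => Y)) _ _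
    fun _ => rfl

/-- The information density is a sum of `n` i.i.d. terms of mean `mutualInfo P W` over letter pairs.
At points of positive weight no logarithm has argument zero, so the threshold test can be read on
the exponents. -/
theorem sum_information_tail_le {W : X → Y → ℝ} (hW : IsTransition W) {P : X → ℝ}
    (hP : P ∈ stdSimplex ℝ X) (hn : 0 < n) {δ : ℝ} (hδ : 0 < δ) (A : (Fin n → X) → (Fin n → Y) → ℝ)
    (hA0 : ∀ x y, 0 ≤ A x y)
    (hA : ∀ x y, piWeight (fun _ => outputDist P W) y
      * Real.exp (n * (mutualInfo P W - δ)) ≤ channelLaw W x y → A x y = 1) :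
    ∑ x, piWeight (fun _ => P) x * ∑ y, channelLaw W x y * (1 - A x y)
      ≤ (∑ u : X × Y, P u.1 * W u.1 u.2 * Real.log (W u.1 u.2 / outputDist P W u.2) ^ 2)
        / δ ^ 2 / n := by
  have hn' : (0 : ℝ) < n := by positivity
  have hT := outputDist_mem_stdSimplex hW hP
  set T := outputDist P W with hTdef
  set q : Fin n → X × Y → ℝ := fun _ u => P u.1 * W u.1 u.2 with hq
  have hq0 : ∀ i u, 0 ≤ q i u := fun i u => mul_nonneg (hP.1 _) ((hW _).1 _)
  have hq1 : ∀ i, ∑ u, q i u = 1 := fun i => by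
    simp only [hq, Fintype.sum_prod_type, ← Finset.mul_sum, (hW _).2, mul_one, hP.2]
  have hqw : ∀ u : Fin n → X × Y, piWeight q u
      = piWeight (fun _ => P) (fun i => (u i).1)
        * channelLaw W (fun i => (u i).1) fun i => (u i).2 :=
    fun u => Finset.prod_mul_distrib
  have hmean : ∀ i, ∑ u, q i u * Real.log (W u.1 u.2 / T u.2) = mutualInfo P W := fun i => by
    simp only [hq, Fintype.sum_prod_type, mutualInfo, hTdef]
  have h := sum_piWeight_le_chebyshev hq0 hq1 (fun _ u => Real.log (W u.1 u.2 / T u.2))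
    (mul_pos hn' hδ) (fun u => 1 - A (fun i => (u i).1) fun i => (u i).2)
    (fun u => by linarith [hA0 (fun i => (u i).1) fun i => (u i).2]) (by
      intro u hu hlt
      rw [hqw] at hu
      simp only [hmean, Finset.sum_const, Finset.card_univ, Fintype.card_fin, nsmul_eq_mul] at hlt
      rw [hA, sub_self]
      have hWu := right_ne_zero_of_mul hu
      have hWu' : ∏ i, W (u i).1 (u i).2 ≠ 0 := hWu
      have hPu := left_ne_zero_of_mul hu
      have hWpos : ∀ i, W (u i).1 (u i).2 ≠ 0 := fun i =>
        Finset.prod_ne_zero_iff.1 hWu' i (Finset.mem_univ i)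
      have hPpos : ∀ i, P (u i).1 ≠ 0 := fun i =>
        Finset.prod_ne_zero_iff.1 hPu i (Finset.mem_univ i)
      have hTpos : ∀ i, 0 < T (u i).2 := fun i =>
        lt_of_lt_of_le (lt_of_le_of_ne (hq0 i (u i)) (mul_ne_zero (hPpos i) (hWpos i)).symm)
          (Finset.single_le_sum (f := fun x => P x * W x (u i).2)
            (fun x _ => mul_nonneg (hP.1 x) ((hW x).1 _)) (Finset.mem_univ _))
      have hTu : piWeight (fun _ => T) (fun i => (u i).2) ≠ 0 :=
        Finset.prod_ne_zero_iff.2 fun i _ => (hTpos i).ne'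
      rw [piWeight_eq_exp (fun _ => hT.1) hTu, channelLaw,
        piWeight_eq_exp (fun i => (hW _).1) hWu, ← Real.exp_add, Real.exp_le_exp]
      have hlog : ∑ i, Real.log (W (u i).1 (u i).2 / T (u i).2)
          = ∑ i, Real.log (W (u i).1 (u i).2) - ∑ i, Real.log (T (u i).2) := by
        rw [← Finset.sum_sub_distrib]
        exact Finset.sum_congr rfl fun i _ => Real.log_div (hWpos i) (hTpos i).ne'
      rw [hlog] at hlt
      linarith [(abs_lt.1 hlt).1])
  simp_rw [hqw] at h
  rw [sum_arrow_prod fun x y => piWeight (fun _ => P) x * channelLaw W x y * (1 - A x y)] at h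
  simp_rw [Finset.mul_sum, ← mul_assoc]
  refine h.trans (le_of_eq ?_)
  simp only [hq, Finset.sum_const, Finset.card_univ, Fintype.card_fin, nsmul_eq_mul]
  field_simp

/-- Weak law of large numbers for `-log T`, whose mean is `entropy T`. -/
theorem sum_entropy_tail_le {T : Y → ℝ} (hT : T ∈ stdSimplex ℝ Y) (hn : 0 < n) {δ : ℝ}
    (hδ : 0 < δ) (A : (Fin n → Y) → ℝ) (hA0 : ∀ y, 0 ≤ A y)
    (hA : ∀ y, piWeight (fun _ => T) y ≤ Real.exp (-(n * (entropy T - δ))) → A y = 1) :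
    ∑ y, piWeight (fun _ => T) y * (1 - A y)
      ≤ (∑ y, T y * (-Real.log (T y)) ^ 2) / δ ^ 2 / n := by
  have hn' : (0 : ℝ) < n := by positivity
  have h := sum_piWeight_le_chebyshev (fun _ : Fin n => hT.1) (fun _ => hT.2)
    (fun _ y => -Real.log (T y)) (mul_pos hn' hδ) (fun y => 1 - A y)
    (fun y => by linarith [hA0 y]) (by
      intro y hy hlt
      change |_ - ∑ _ : Fin n, entropy T| < _ at hlt
      simp only [Finset.sum_const, Finset.card_univ, Fintype.card_fin, nsmul_eq_mul,
        Finset.sum_neg_distrib] at hlt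
      rw [hA, sub_self]
      rw [piWeight_eq_exp (fun _ => hT.1) hy, Real.exp_le_exp]
      linarith [(abs_lt.1 hlt).1])
  refine h.trans (le_of_eq ?_)
  simp only [Finset.sum_const, Finset.card_univ, Fintype.card_fin, nsmul_eq_mul]
  field_simp

variable [DecidableEq Y]

omit [Fintype X] in
theorem sum_cloudWeight_mul_sum_replicas {W : X → Y → ℝ} (hW : IsTransition W) (hL : 0 < L)
    (x : Fin n → X) (g : (Fin n → Y) → ℝ) :
    ∑ v : Fin L → Fin n → Y, cloudWeight W L x v * ∑ y, replicas v y / L * g y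
      = ∑ y, channelLaw W x y * g y := by
  have hL' : (L : ℝ) ≠ 0 := by positivity
  simp_rw [Finset.mul_sum]
  rw [Finset.sum_comm]
  refine Finset.sum_congr rfl fun y _ => ?_
  have h : ∀ v : Fin L → Fin n → Y, cloudWeight W L x v * (replicas v y / L * g y)
      = cloudWeight W L x v * replicas v y * (g y / L) := fun v => by ring
  simp_rw [h]
  rw [← Finset.sum_mul, sum_cloudWeight_mul_replicas hW]
  field_simp

omit [Fintype X] in
theorem mem_achievableRates_of_bound [Nonempty X] {W : X → Y → ℝ} (hW : IsTransition W) {K R : ℝ}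
    (hR : 0 ≤ R) {b : ℕ → ℝ} (hb : Filter.Tendsto b Filter.atTop (nhds 0))
    (h : ∀ n : ℕ, 0 < n → ∃ c : Fin ⌊Real.exp (n * R)⌋₊ → Fin n → X,
      avgError W ⌊Real.exp (n * K)⌋₊ c ≤ b n) : R ∈ achievableRates W K := by
  have h' : ∀ n : ℕ, ∃ c : Fin ⌊Real.exp (n * R)⌋₊ → Fin n → X,
      0 < n → avgError W ⌊Real.exp (n * K)⌋₊ c ≤ b n := by
    intro n
    rcases Nat.eq_zero_or_pos n with hn | hn
    · exact ⟨fun _ _ => Classical.arbitrary X, fun h => absurd hn h.ne'⟩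
    · obtain ⟨c, hc⟩ := h n hn
      exact ⟨c, fun _ => hc⟩
  choose c hc using h'
  refine ⟨hR, c, tendsto_of_tendsto_of_tendsto_of_le_of_le' tendsto_const_nhds hb ?_ ?_⟩
  · exact Filter.Eventually.of_forall fun n => avgError_nonneg hW _ _
  · filter_upwards [Filter.eventually_gt_atTop 0] with n hn using hc n hn

theorem mem_achievableRates_of_lt_mutualInfo [Nonempty X] {W : X → Y → ℝ} (hW : IsTransition W)
    {P : X → ℝ} (hP : P ∈ stdSimplex ℝ X) {K R : ℝ} (hK : 0 ≤ K) (hR : 0 ≤ R)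
    (hlt : R < mutualInfo P W) : R ∈ achievableRates W K := by
  set δ := (mutualInfo P W - R) / 2 with hδdef
  have hδ : 0 < δ := by rw [hδdef]; linarith
  set V := ∑ u : X × Y, P u.1 * W u.1 u.2 * Real.log (W u.1 u.2 / outputDist P W u.2) ^ 2
  refine mem_achievableRates_of_bound hW (b := fun n => V / δ ^ 2 / n + Real.exp (n * (-δ))) hR
    ?_ fun n hn => ?_
  · simpa using (tendsto_const_div_atTop_nhds_zero_nat (V / δ ^ 2)).add
      (tendsto_exp_nat_mul_of_neg (neg_lt_zero.2 hδ))
  classical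
  set M := ⌊Real.exp (n * R)⌋₊
  set L := ⌊Real.exp (n * K)⌋₊
  have hL : 0 < L := floor_exp_pos hK n
  have hT := outputDist_mem_stdSimplex hW hP
  set T := outputDist P W with hTdef
  set γ := Real.exp (n * (mutualInfo P W - δ)) with hγ
  have hγ0 : 0 < γ := Real.exp_pos _
  set A : (Fin n → X) → (Fin n → Y) → ℝ :=
    fun x y => if piWeight (fun _ => T) y * γ ≤ channelLaw W x y then 1 else 0 with hA
  obtain ⟨c, hc⟩ := exists_avgError_le (L := L) hW hP (floor_exp_pos hR n) hL (fun x _ y => A x y)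
    fun x v y => by simp only [hA]; split_ifs <;> simp
  refine ⟨c, hc.trans (add_le_add ?_ ?_)⟩
  · simp_rw [sum_cloudWeight_mul_sum_replicas hW hL]
    exact sum_information_tail_le hW hP hn hδ A
      (fun x y => by simp only [hA]; split_ifs <;> simp) fun x y h => if_pos h
  · simp_rw [← Finset.sum_mul, sum_cloudWeight hW, one_mul]
    -- Change of measure: acceptance forces the product output law to be at most `γ⁻¹ * channelLaw W
    -- x y`, and the latter has total mass one.
    have hE : ∑ y : Fin n → Y, piWeight (fun _ => T) y * ∑ x, piWeight (fun _ => P) x * A x y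
        ≤ γ⁻¹ := by
      calc _ ≤ ∑ y : Fin n → Y, γ⁻¹ * piWeight (fun _ => T) y := by
            refine Finset.sum_le_sum fun y _ => ?_
            rw [Finset.mul_sum]
            conv_rhs => rw [hTdef, ← sum_piWeight_mul_channelLaw, Finset.mul_sum]
            refine Finset.sum_le_sum fun x _ => ?_
            rw [mul_left_comm, mul_left_comm γ⁻¹]
            refine mul_le_mul_of_nonneg_left ?_ (piWeight_nonneg (fun _ => hP.1) x)
            simp only [hA]
            split_ifs with h
            · rw [mul_one, inv_mul_eq_div, le_div_iff₀ hγ0]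
              exact h
            · rw [mul_zero]
              exact mul_nonneg (by positivity) (channelLaw_nonneg hW x y)
        _ = γ⁻¹ := by rw [← Finset.mul_sum, sum_piWeight fun _ => hT.2, mul_one]
    calc _ ≤ Real.exp (n * R) * γ⁻¹ := by
          refine mul_le_mul (Nat.floor_le (Real.exp_pos _).le) hE ?_ (Real.exp_pos _).le
          refine Finset.sum_nonneg fun y _ => mul_nonneg (piWeight_nonneg (fun _ => hT.1) y)
            (Finset.sum_nonneg fun x _ => mul_nonneg (piWeight_nonneg (fun _ => hP.1) x) ?_)
          simp only [hA]
          split_ifs <;> simp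
      _ = _ := by
          rw [hγ, ← Real.exp_neg, ← Real.exp_add, hδdef]
          congr 1
          ring

theorem mem_achievableRates_of_lt_entropy [Nonempty X] {W : X → Y → ℝ} (hW : IsTransition W)
    {P : X → ℝ} (hP : P ∈ stdSimplex ℝ X) {K R : ℝ} (hK : 0 ≤ K) (hR : 0 ≤ R)
    (hlt : R < entropy (outputDist P W) - K) : R ∈ achievableRates W K := by
  have hT := outputDist_mem_stdSimplex hW hP
  set T := outputDist P W with hTdef
  set δ := (entropy T - K - R) / 2 with hδdef
  have hδ : 0 < δ := by rw [hδdef]; linarith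
  set V := ∑ y, T y * (-Real.log (T y)) ^ 2
  refine mem_achievableRates_of_bound hW (b := fun n => V / δ ^ 2 / n + Real.exp (n * (-δ))) hR
    ?_ fun n hn => ?_
  · simpa using (tendsto_const_div_atTop_nhds_zero_nat (V / δ ^ 2)).add
      (tendsto_exp_nat_mul_of_neg (neg_lt_zero.2 hδ))
  classical
  set M := ⌊Real.exp (n * R)⌋₊
  set L := ⌊Real.exp (n * K)⌋₊ with hLdef
  have hL : 0 < L := floor_exp_pos hK n
  set γ := Real.exp (-(n * (entropy T - δ))) with hγ
  have hγ0 : 0 < γ := Real.exp_pos _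
  set B : (Fin n → Y) → ℝ := fun y => if piWeight (fun _ => T) y ≤ γ then 1 else 0 with hB
  have hB0 : ∀ y, 0 ≤ B y := fun y => by simp only [hB]; split_ifs <;> simp
  -- A message is accepted when its cloud contains `y` and `y` is not too likely. The sent cloud
  -- always contains the output, so only the test `B` can reject the true message.
  set A : (Fin n → X) → (Fin L → Fin n → Y) → (Fin n → Y) → ℝ :=
    fun _ v y => if ∃ l, v l = y then B y else 0 with hA
  obtain ⟨c, hc⟩ := exists_avgError_le (L := L) hW hP (floor_exp_pos hR n) hL A
    fun x v y => by simp only [hA, hB]; split_ifs <;> simp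
  refine ⟨c, hc.trans (add_le_add ?_ ?_)⟩
  · have h1 : ∀ (x : Fin n → X) (v : Fin L → Fin n → Y) (y : Fin n → Y),
        replicas v y / L * (1 - A x v y) = replicas v y / L * (1 - B y) := by
      intro x v y
      simp only [hA]
      split_ifs with h
      · rfl
      · have : replicas v y = 0 := Finset.sum_eq_zero fun l _ => if_neg fun hl => h ⟨l, hl⟩
        simp [this]
    simp_rw [h1, sum_cloudWeight_mul_sum_replicas hW hL, Finset.mul_sum]
    rw [Finset.sum_comm]
    simp_rw [← mul_assoc, ← Finset.sum_mul, sum_piWeight_mul_channelLaw, ← hTdef]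
    exact sum_entropy_tail_le hT hn hδ B hB0 fun y h => if_pos h
  -- Markov's inequality: the indicator of `y` lying in the cloud is at most its number of replicas,
  -- of mean `L * channelLaw W x y`.
  · have ha : ∀ (x : Fin n → X) (y : Fin n → Y), ∑ v, cloudWeight W L x v * A x v y
        ≤ L * channelLaw W x y * B y := by
      intro x y
      rw [← sum_cloudWeight_mul_replicas hW, Finset.sum_mul]
      refine Finset.sum_le_sum fun v _ => ?_
      rw [mul_assoc]
      refine mul_le_mul_of_nonneg_left ?_ (cloudWeight_nonneg hW x v)
      simp only [hA]
      split_ifs with h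
      · obtain ⟨l, hl⟩ := h
        have : (1 : ℝ) ≤ replicas v y := by
          have := Finset.single_le_sum (f := fun l => if v l = y then (1 : ℝ) else 0)
            (fun l _ => by positivity) (Finset.mem_univ l)
          exact (le_of_eq (if_pos hl).symm).trans this
        exact le_mul_of_one_le_left (hB0 y) this
      · exact mul_nonneg (replicas_nonneg v y) (hB0 y)
    have hE : ∑ y : Fin n → Y, piWeight (fun _ => T) y *
        ∑ x, piWeight (fun _ => P) x * ∑ v, cloudWeight W L x v * A x v y ≤ L * γ := by
      calc _ ≤ ∑ y : Fin n → Y, piWeight (fun _ => T) y * (L * γ) := by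
            refine Finset.sum_le_sum fun y _ => mul_le_mul_of_nonneg_left ?_
              (piWeight_nonneg (fun _ => hT.1) y)
            calc _ ≤ ∑ x, piWeight (fun _ => P) x * (L * channelLaw W x y * B y) :=
                  Finset.sum_le_sum fun x _ => mul_le_mul_of_nonneg_left (ha x y)
                    (piWeight_nonneg (fun _ => hP.1) x)
              _ = L * (piWeight (fun _ => T) y * B y) := by
                  rw [hTdef, ← sum_piWeight_mul_channelLaw, Finset.sum_mul, Finset.mul_sum]
                  exact Finset.sum_congr rfl fun x _ => by ring
              _ ≤ L * γ := by
                  refine mul_le_mul_of_nonneg_left ?_ (by positivity)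
                  simp only [hB]
                  split_ifs with h
                  · simpa using h
                  · simpa using hγ0.le
        _ = L * γ := by rw [← Finset.sum_mul, sum_piWeight fun _ => hT.2, one_mul]
    calc _ ≤ Real.exp (n * R) * (Real.exp (n * K) * γ) := by
          refine mul_le_mul (Nat.floor_le (Real.exp_pos _).le) (hE.trans ?_) ?_ (Real.exp_pos _).le
          · gcongr
            exact Nat.floor_le (Real.exp_pos _).le
          · refine Finset.sum_nonneg fun y _ => mul_nonneg (piWeight_nonneg (fun _ => hT.1) y)
              (Finset.sum_nonneg fun x _ => mul_nonneg (piWeight_nonneg (fun _ => hP.1) x)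
                (Finset.sum_nonneg fun v _ => mul_nonneg (cloudWeight_nonneg hW x v) ?_))
            simp only [hA]
            split_ifs
            exacts [hB0 y, le_rfl]
      _ = _ := by
          rw [hγ, ← Real.exp_add, ← Real.exp_add, hδdef]
          congr 1
          ring

end Achievability

/-! ### Converse -/

section Converse

variable {X Y : Type*} [Fintype X] [Fintype Y] {M L n : ℕ}

/-! ### Success probability and second moments of replica counts -/

section Success

variable [DecidableEq Y]

omit [Fintype X] in
theorem one_sub_avgError_le_of_bound {W : X → Y → ℝ} (hW : IsTransition W) (hM : 0 < M)
    (hL : 0 < L) (c : Fin M → Fin n → X) (S : (Fin M → Fin L → Fin n → Y) → ℝ)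
    (hS : ∀ ω (m₀ : (Fin n → Y) → Fin M), ∑ y, cloudLaw ω (m₀ y) y ≤ S ω) :
    1 - avgError W L c ≤ (1 / (M : ℝ)) * ∑ ω, instanceProb W c ω * S ω := by
  have h : ∀ ω : Fin M → Fin L → Fin n → Y, 1 - (1 / (M : ℝ)) * S ω ≤ instanceError ω := by
    intro ω
    obtain ⟨m₀, -, h⟩ := exists_instanceError_eq hM hL ω
    rw [h]
    gcongr
    exact hS ω m₀
  have h2 : ∑ ω, instanceProb W c ω * (1 - (1 / (M : ℝ)) * S ω) ≤ avgError W L c :=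
    Finset.sum_le_sum fun ω _ => mul_le_mul_of_nonneg_left (h ω) (instanceProb_nonneg hW c ω)
  simp_rw [mul_sub, mul_one, Finset.sum_sub_distrib, sum_instanceProb hW,
    mul_left_comm _ (1 / (M : ℝ)), ← Finset.mul_sum] at h2
  linarith

omit [Fintype X] in
/-- Bound on the success probability when the codewords are sorted into classes. Outside of the
exceptional event `φ`, a sequence received for a codeword of the class `P` belongs to `B P` and is
generated with probability at most `w P`. -/
theorem one_sub_avgError_le {W : X → Y → ℝ} (hW : IsTransition W) (hM : 0 < M)
    (hL : 0 < L) (c : Fin M → Fin n → X) {ι : Type*} (τ : Fin M → ι) (F : Finset ι)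
    (hτ : ∀ m, τ m ∈ F) (B : ι → Finset (Fin n → Y)) (w θ : ι → ℝ) (hw0 : ∀ P, 0 ≤ w P)
    (hθ : ∀ P, 0 < θ P)
    (φ : Fin M → (Fin n → Y) → ℝ) (hφ0 : ∀ m y, 0 ≤ φ m y)
    (hφ : ∀ m y, φ m y < 1 → y ∈ B (τ m) ∧ channelLaw W (c m) y ≤ w (τ m)) :
    1 - avgError W L c ≤ (1 / (M : ℝ)) * (∑ P ∈ F, (B P).card * (θ P / L)
      + ∑ m, ((1 + L * w (τ m)) / θ (τ m) + ∑ y, channelLaw W (c m) y * φ m y)) := by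
  have hL' : (0 : ℝ) < L := by positivity
  -- The excess over `θ / L`, summed over all messages to dominate the one at the maximiser: the
  -- second-moment term in the regular case, the whole likelihood in the exceptional one, where `φ ≥
  -- 1`.
  set s : Fin M → (Fin n → Y) → (Fin L → Fin n → Y) → ℝ := fun m y v =>
    if φ m y < 1 then replicas v y ^ 2 / (L * θ (τ m)) else replicas v y / L * φ m y with hs
  have hs0 : ∀ m y v, 0 ≤ s m y v := by
    intro m y v
    have := replicas_nonneg v y
    have := hθ (τ m)
    have := hφ0 m y
    simp only [hs]
    split_ifs <;> positivity
  refine (one_sub_avgError_le_of_bound hW hM hL c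
    (fun ω => ∑ P ∈ F, (B P).card * (θ P / L) + ∑ m, ∑ y, s m y (ω m)) fun ω m₀ => ?_).trans ?_
  · have hcard : ∀ P, ((B P).card : ℝ) * (θ P / L) = ∑ y, if y ∈ B P then θ P / L else 0 := by
      intro P
      simp
    simp_rw [hcard]
    rw [Finset.sum_comm, Finset.sum_comm (s := Finset.univ (α := Fin M)), ← Finset.sum_add_distrib]
    refine Finset.sum_le_sum fun y _ => ?_
    set m := m₀ y
    have h1 : s m y (ω m) ≤ ∑ m, s m y (ω m) :=
      Finset.single_le_sum (f := fun m => s m y (ω m)) (fun m _ => hs0 m y (ω m))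
        (Finset.mem_univ m)
    have hF0 : ∀ P ∈ F, 0 ≤ if y ∈ B P then θ P / L else 0 := fun P _ => by
      have := hθ P
      split_ifs <;> positivity
    have hN := replicas_nonneg (ω m) y
    refine le_trans ?_ (add_le_add_right h1 _)
    rw [cloudLaw_eq]
    by_cases h : φ m y < 1
    · have h2 := Finset.single_le_sum hF0 (hτ m)
      rw [if_pos (hφ m y h).1] at h2
      refine le_trans ?_ (add_le_add_left h2 _)
      simp only [hs, if_pos h]
      have := hθ (τ m)
      rw [div_add_div _ _ hL'.ne' (by positivity), div_le_div_iff₀ hL' (by positivity)]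
      have h3 : replicas (ω m) y * θ (τ m) ≤ θ (τ m) ^ 2 + replicas (ω m) y ^ 2 := by
        nlinarith [sq_nonneg (replicas (ω m) y - θ (τ m)), mul_nonneg hN this.le]
      nlinarith [mul_le_mul_of_nonneg_left h3 (by positivity : (0 : ℝ) ≤ L * L)]
    · simp only [hs, if_neg h]
      have h4 : replicas (ω m) y / L ≤ replicas (ω m) y / L * φ m y :=
        le_mul_of_one_le_right (by positivity) (not_lt.1 h)
      linarith [Finset.sum_nonneg hF0]
  · gcongr (1 / (M : ℝ)) * ?_
    simp_rw [mul_add, Finset.sum_add_distrib, ← Finset.sum_mul, sum_instanceProb hW, one_mul,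
      ← Finset.sum_add_distrib]
    gcongr _ + ?_
    simp_rw [Finset.mul_sum (ι := Fin M)]
    rw [Finset.sum_comm]
    refine Finset.sum_le_sum fun m _ => ?_
    have h5 : ∑ ω, instanceProb W c ω * ∑ y, s m y (ω m)
        = ∑ v, cloudWeight W L (c m) v * ∑ y, s m y v :=
      sum_piWeight_single (fun m => sum_cloudWeight hW L (c m)) m fun v => ∑ y, s m y v
    rw [h5]
    simp_rw [Finset.mul_sum (ι := Fin n → Y)]
    rw [Finset.sum_comm]
    have := hθ (τ m)
    have h6 : ∀ y, ∑ v, cloudWeight W L (c m) v * s m y v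
        ≤ channelLaw W (c m) y * ((1 + L * w (τ m)) / θ (τ m)) + channelLaw W (c m) y * φ m y := by
      intro y
      have hp := channelLaw_nonneg hW (c m) y
      by_cases h : φ m y < 1
      · simp only [hs, if_pos h, ← mul_div_assoc, ← Finset.sum_div]
        have hw := (hφ m y h).2
        have h7 : (∑ v : Fin L → Fin n → Y, cloudWeight W L (c m) v * replicas v y ^ 2)
            / (L * θ (τ m)) ≤ channelLaw W (c m) y * (1 + L * w (τ m)) / θ (τ m) := by
          rw [div_le_div_iff₀ (by positivity) this]
          calc _ ≤ L * channelLaw W (c m) y * (1 + L * channelLaw W (c m) y) * θ (τ m) := by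
                gcongr
                exact sum_cloudWeight_mul_replicas_sq_le hW (c m) y
            _ ≤ L * channelLaw W (c m) y * (1 + L * w (τ m)) * θ (τ m) := by gcongr
            _ = _ := by ring
        linarith [mul_nonneg hp (hφ0 m y)]
      · simp only [hs, if_neg h, ← mul_assoc, ← mul_div_assoc, ← Finset.sum_div, ← Finset.sum_mul,
          sum_cloudWeight_mul_replicas hW, mul_div_cancel_left₀ _ hL'.ne']
        have := hw0 (τ m)
        exact le_add_of_nonneg_left (by positivity)
    refine (Finset.sum_le_sum fun y _ => h6 y).trans (le_of_eq ?_)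
    rw [Finset.sum_add_distrib, ← Finset.sum_mul, sum_channelLaw hW, one_mul]

end Success

/-- The empirical distribution of the letters of `x`. -/
def empirical (x : Fin n → X) (a : X) : ℝ := by
  classical exact ((Finset.univ.filter fun i => x i = a).card : ℝ) / n

theorem sum_eq_mul_sum_empirical (hn : 0 < n) (x : Fin n → X) (f : X → ℝ) :
    ∑ i, f (x i) = n * ∑ a, empirical x a * f a := by
  classical
  have hn' : (n : ℝ) ≠ 0 := by positivity
  have h : ∀ a, n * (empirical x a * f a) = ∑ i, if x i = a then f a else 0 := by
    intro a
    rw [← Finset.sum_filter, Finset.sum_const, nsmul_eq_mul]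
    simp only [empirical]
    field_simp
  rw [Finset.mul_sum]
  simp_rw [h]
  rw [Finset.sum_comm]
  simp

theorem empirical_mem_stdSimplex (hn : 0 < n) (x : Fin n → X) :
    empirical x ∈ stdSimplex ℝ X := by
  have hn' : (0 : ℝ) < n := by positivity
  refine ⟨fun a => by unfold empirical; positivity, ?_⟩
  have h := sum_eq_mul_sum_empirical hn x fun _ => 1
  simp only [Finset.sum_const, Finset.card_univ, Fintype.card_fin, nsmul_eq_mul, mul_one] at h
  exact mul_left_cancel₀ hn'.ne' (by rw [← h, mul_one])

/-- Each letter count takes one of `n + 1` values, so the classes are polynomially many. -/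
theorem ncard_range_empirical_le :
    (Set.range (empirical : (Fin n → X) → X → ℝ)).ncard ≤ (n + 1) ^ Fintype.card X := by
  classical
  have hsub : Set.range (empirical : (Fin n → X) → X → ℝ)
      ⊆ Set.range fun (k : X → Fin (n + 1)) a => ((k a : ℕ) : ℝ) / n := by
    rintro _ ⟨x, rfl⟩
    refine ⟨fun a => ⟨(Finset.univ.filter fun i => x i = a).card,
      Nat.lt_succ_of_le ((Finset.card_le_univ _).trans (by simp))⟩, ?_⟩
    funext a
    simp only [empirical]
  refine (Set.ncard_le_ncard hsub (Set.finite_range _)).trans ?_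
  rw [← Set.image_univ]
  refine (Set.ncard_image_le Set.finite_univ).trans ?_
  simp [Set.ncard_univ, Nat.card_eq_fintype_card]

theorem mul_log_sq_le {t : ℝ} (h0 : 0 ≤ t) (h1 : t ≤ 1) : t * (-Real.log t) ^ 2 ≤ 4 := by
  rcases h0.eq_or_lt with rfl | hpos
  · simp
  -- With `s = √t`, squaring `|s log s| < 1` gives `t (log t)² / 4 < 1`; this makes the Chebyshev
  -- bounds uniform over all distributions.
  have h := Real.abs_log_mul_self_lt (Real.sqrt t) (Real.sqrt_pos.2 hpos) (Real.sqrt_le_one.2 h1)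
  rw [Real.log_sqrt h0] at h
  have h2 : (Real.log t / 2 * Real.sqrt t) ^ 2 < 1 := by
    rw [← sq_abs]
    exact pow_lt_one₀ (abs_nonneg _) h two_ne_zero
  rw [mul_pow, Real.sq_sqrt h0] at h2
  nlinarith

theorem sum_mul_log_sq_le {T : Y → ℝ} (hT : T ∈ stdSimplex ℝ Y) :
    ∑ y, T y * (-Real.log (T y)) ^ 2 ≤ 4 * Fintype.card Y := by
  refine (Finset.sum_le_sum fun y _ => mul_log_sq_le (hT.1 y) ?_).trans (by simp [mul_comm])
  rw [← hT.2]
  exact Finset.single_le_sum (fun y _ => hT.1 y) (Finset.mem_univ y)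

/-- The output sequences that are not too unlikely for independent letters of distribution `T`. -/
def typicalOutputs (T : Y → ℝ) (n : ℕ) (δ : ℝ) : Finset (Fin n → Y) := by
  classical exact Finset.univ.filter fun y =>
    Real.exp (-(n * (entropy T + δ))) ≤ piWeight (fun _ => T) y

theorem mem_typicalOutputs {T : Y → ℝ} {δ : ℝ} {y : Fin n → Y} :
    y ∈ typicalOutputs T n δ ↔ Real.exp (-(n * (entropy T + δ))) ≤ piWeight (fun _ => T) y := by
  simp [typicalOutputs]

/-- The members are disjoint events of probability at least `exp (-(n * (entropy T + δ)))` each, and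
the total is at most one. -/
theorem card_typicalOutputs_le {T : Y → ℝ} (hT : T ∈ stdSimplex ℝ Y) (n : ℕ) (δ : ℝ) :
    ((typicalOutputs T n δ).card : ℝ) ≤ Real.exp (n * (entropy T + δ)) := by
  have h : ∑ y ∈ typicalOutputs T n δ, Real.exp (-(n * (entropy T + δ))) ≤ 1 := by
    rw [← sum_piWeight (fun _ : Fin n => hT.2)]
    refine (Finset.sum_le_sum fun y hy => mem_typicalOutputs.1 hy).trans ?_
    exact Finset.sum_le_sum_of_subset_of_nonneg (Finset.subset_univ _)
      fun y _ _ => piWeight_nonneg (fun _ => hT.1) y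
  rw [Finset.sum_const, nsmul_eq_mul, Real.exp_neg] at h
  rwa [mul_inv_le_iff₀ (Real.exp_pos _), one_mul] at h

/-- Under the channel law of `x`, the output is typical for the output distribution of the
empirical distribution of `x`, up to a small probability. -/
theorem sum_not_mem_typicalOutputs_le {W : X → Y → ℝ} (hW : IsTransition W) (hn : 0 < n)
    {δ : ℝ} (hδ : 0 < δ) (x : Fin n → X) (φ : (Fin n → Y) → ℝ) (hφ1 : ∀ y, φ y ≤ 1)
    (hφ : ∀ y ∈ typicalOutputs (outputDist (empirical x) W) n δ, φ y ≤ 0) :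
    ∑ y, channelLaw W x y * φ y ≤ 4 * Fintype.card Y / δ ^ 2 / n := by
  classical
  have hn' : (0 : ℝ) < n := by positivity
  have hP := empirical_mem_stdSimplex hn x
  have hT := outputDist_mem_stdSimplex hW hP
  set T := outputDist (empirical x) W with hTdef
  -- The output letters are not identically distributed, but their laws average over positions to
  -- `T`.
  have hsum : ∀ g : Y → ℝ, ∑ i, ∑ y, W (x i) y * g y = n * ∑ y, T y * g y := by
    intro g
    rw [sum_eq_mul_sum_empirical hn x fun a => ∑ y, W a y * g y]
    simp_rw [hTdef, outputDist, Finset.sum_mul, Finset.mul_sum, ← mul_assoc]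
    rw [Finset.sum_comm]
  have h := sum_piWeight_le_chebyshev (fun i => (hW (x i)).1) (fun i => (hW (x i)).2)
    (fun _ y => -Real.log (T y)) (mul_pos hn' hδ) φ hφ1 (by
      intro y hy hlt
      refine hφ y (mem_typicalOutputs.2 ?_)
      rw [hsum] at hlt
      change |_ - n * entropy T| < _ at hlt
      -- A letter that occurs in `x` has positive empirical weight, so `T` charges every output
      -- letter it can produce.
      have hTy : piWeight (fun _ => T) y ≠ 0 := by
        refine Finset.prod_ne_zero_iff.2 fun i hi h0 => ?_
        have hWi : W (x i) (y i) ≠ 0 := Finset.prod_ne_zero_iff.1 hy i hi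
        have h1 := (Finset.sum_eq_zero_iff_of_nonneg
          fun a _ => mul_nonneg (hP.1 a) ((hW a).1 (y i))).1 h0 (x i) (Finset.mem_univ _)
        have h2 : empirical x (x i) = 0 := (mul_eq_zero.1 h1).resolve_right hWi
        simp only [empirical, div_eq_zero_iff, Nat.cast_eq_zero, Finset.card_eq_zero,
          hn.ne', or_false] at h2
        exact Finset.filter_eq_empty_iff.1 h2 (Finset.mem_univ i) rfl
      rw [piWeight_eq_exp (fun _ => hT.1) hTy, Real.exp_le_exp]
      rw [Finset.sum_neg_distrib] at hlt
      linarith [(abs_lt.1 hlt).2])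
  rw [hsum] at h
  refine h.trans ?_
  calc _ ≤ n * (4 * Fintype.card Y) / (n * δ) ^ 2 := by
        gcongr
        exact sum_mul_log_sq_le hT
    _ = _ := by field_simp

/-- Weak law for `-log W`, whose mean over the positions is the conditional entropy of the type of
`x`. -/
theorem sum_channelLaw_large_le {W : X → Y → ℝ} (hW : IsTransition W) (hn : 0 < n)
    {δ : ℝ} (hδ : 0 < δ) (x : Fin n → X) (φ : (Fin n → Y) → ℝ) (hφ1 : ∀ y, φ y ≤ 1)
    (hφ : ∀ y, channelLaw W x y ≤ Real.exp (-(n * (∑ a, empirical x a * entropy (W a) - δ))) →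
      φ y ≤ 0) :
    ∑ y, channelLaw W x y * φ y ≤ 4 * Fintype.card Y / δ ^ 2 / n := by
  have hn' : (0 : ℝ) < n := by positivity
  have h := sum_piWeight_le_chebyshev (fun i => (hW (x i)).1) (fun i => (hW (x i)).2)
    (fun i y => -Real.log (W (x i) y)) (mul_pos hn' hδ) φ hφ1 (by
      intro y hy hlt
      refine hφ y ?_
      change |_ - ∑ i, entropy (W (x i))| < _ at hlt
      rw [sum_eq_mul_sum_empirical hn x fun a => entropy (W a), Finset.sum_neg_distrib] at hlt
      rw [channelLaw, piWeight_eq_exp (fun i => (hW (x i)).1) hy, Real.exp_le_exp]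
      linarith [(abs_lt.1 hlt).1])
  refine h.trans ?_
  calc _ ≤ (∑ _ : Fin n, 4 * (Fintype.card Y : ℝ)) / (n * δ) ^ 2 := by
        gcongr with i
        exact sum_mul_log_sq_le (hW (x i))
    _ = _ := by
        simp only [Finset.sum_const, Finset.card_univ, Fintype.card_fin, nsmul_eq_mul]
        field_simp

/-! ### Exponents, asymptotics and the capacity -/

theorem exp_div_two_le_floor {a : ℝ} (ha : 0 ≤ a) : Real.exp a / 2 ≤ ⌊Real.exp a⌋₊ := by
  have h1 := Nat.lt_floor_add_one (Real.exp a)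
  have h2 : (1 : ℝ) ≤ ⌊Real.exp a⌋₊ := by
    exact_mod_cast Nat.floor_pos.2 (Real.one_le_exp ha)
  linarith

theorem tendsto_succ_pow_mul_exp_neg (k : ℕ) {δ : ℝ} (hδ : 0 < δ) :
    Filter.Tendsto (fun n : ℕ => ((n : ℝ) + 1) ^ k * Real.exp (n * (-δ))) Filter.atTop
      (nhds 0) := by
  have h := tendsto_pow_const_mul_const_pow_of_abs_lt_one k (r := Real.exp (-δ))
    (by rw [abs_of_pos (Real.exp_pos _)]; simpa using hδ)
  have h2 := ((Filter.tendsto_add_atTop_iff_nat 1).2 h).mul_const (Real.exp δ)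
  rw [zero_mul] at h2
  refine h2.congr fun n => ?_
  rw [mul_assoc, ← Real.exp_nat_mul, ← Real.exp_add]
  push_cast
  congr 2
  ring

variable [DecidableEq Y]

theorem one_sub_avgError_le_of_size [Nonempty X] {W : X → Y → ℝ} (hW : IsTransition W)
    {K R C δ : ℝ} (hδ : 0 < δ) (hI : shannonCapacity W ≤ C) (hH : maxOutputEntropy W - K ≤ C)
    (hn : 0 < n) (hM : 0 < M) (hL : 0 < L) (hMlow : Real.exp (n * R) / 2 ≤ M)
    (hLlow : Real.exp (n * K) / 2 ≤ L) (c : Fin M → Fin n → X) :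
    1 - avgError W L c ≤
      6 * (((n : ℝ) + 1) ^ Fintype.card X * Real.exp (n * (C + 3 * δ - R)))
        + (Real.exp (n * (-δ)) + 8 * Fintype.card Y / δ ^ 2 / n) := by
  classical
  have hn' : (0 : ℝ) < n := by positivity
  have hM' : (0 : ℝ) < M := by positivity
  have hL' : (0 : ℝ) < L := by positivity
  set B : (X → ℝ) → Finset (Fin n → Y) := fun P => typicalOutputs (outputDist P W) n δ with hB
  set h : (X → ℝ) → ℝ := fun P => ∑ a, P a * entropy (W a) with hh
  set w : (X → ℝ) → ℝ := fun P => Real.exp (-(n * (h P - δ))) with hw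
  have hw0 : ∀ P, 0 ≤ w P := fun P => (Real.exp_pos _).le
  -- This choice turns the second-moment term into exactly `exp (-n δ)`, while `θ / L = exp (n δ) *
  -- (1/L + w)` separates the two exponents of the maximum.
  set θ : (X → ℝ) → ℝ := fun P => Real.exp (n * δ) * (1 + L * w P) with hθ
  have hw1 : ∀ P, 0 < 1 + L * w P := fun P => by have := hw0 P; positivity
  have hθ0 : ∀ P, 0 < θ P := fun P => mul_pos (Real.exp_pos _) (hw1 P)
  set φ₁ : Fin M → (Fin n → Y) → ℝ := fun m y => if y ∈ B (empirical (c m)) then 0 else 1 with hφ₁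
  set φ₂ : Fin M → (Fin n → Y) → ℝ :=
    fun m y => if channelLaw W (c m) y ≤ w (empirical (c m)) then 0 else 1 with hφ₂
  have hφ₁0 : ∀ m y, 0 ≤ φ₁ m y := fun m y => by simp only [hφ₁]; split_ifs <;> simp
  have hφ₂0 : ∀ m y, 0 ≤ φ₂ m y := fun m y => by simp only [hφ₂]; split_ifs <;> simp
  have hfin : (Set.range (empirical : (Fin n → X) → X → ℝ)).Finite := Set.finite_range _
  set F := hfin.toFinset with hF
  have hFcard : (F.card : ℝ) ≤ ((n : ℝ) + 1) ^ Fintype.card X := by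
    rw [hF, ← Set.ncard_eq_toFinset_card _ hfin]
    exact_mod_cast ncard_range_empirical_le
  have key := one_sub_avgError_le hW hM hL c (fun m => empirical (c m)) F (fun m => by simp [hF])
    B w θ hw0 hθ0 (fun m y => φ₁ m y + φ₂ m y) (fun m y => add_nonneg (hφ₁0 m y) (hφ₂0 m y)) (by
      intro m y hlt
      constructor
      · by_contra hcon
        have : φ₁ m y = 1 := if_neg hcon
        linarith [hφ₂0 m y]
      · by_contra hcon
        have : φ₂ m y = 1 := if_neg hcon
        linarith [hφ₁0 m y])
  -- The factor is `3 = 2 + 1`, the `2` coming from the floor in `L`; the floor in `M` later doubles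
  -- it to `6`.
  have hclass : ∀ P ∈ F, ((B P).card : ℝ) * (θ P / L) ≤ 3 * Real.exp (n * (C + 3 * δ)) := by
    intro P hPF
    have hP : P ∈ stdSimplex ℝ X := by
      obtain ⟨x, rfl⟩ := hfin.mem_toFinset.1 hPF
      exact empirical_mem_stdSimplex hn x
    have hIP : entropy (outputDist P W) - h P ≤ C := by
      rw [← mutualInfo_eq hW hP]
      exact ((isGreatest_shannonCapacity hW).2 ⟨P, hP, rfl⟩).trans hI
    have hHP : entropy (outputDist P W) - K ≤ C :=
      (sub_le_sub_right ((isGreatest_maxOutputEntropy W).2 ⟨P, hP, rfl⟩) K).trans hH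
    have hLinv : 1 / (L : ℝ) ≤ 2 * Real.exp (-(n * K)) := by
      rw [Real.exp_neg, div_le_iff₀ hL', mul_assoc, ← div_eq_inv_mul, ← mul_div_assoc,
        le_div_iff₀ (Real.exp_pos _)]
      linarith
    calc ((B P).card : ℝ) * (θ P / L)
        ≤ Real.exp (n * (entropy (outputDist P W) + δ)) *
          (Real.exp (n * δ) * (1 / L + w P)) := by
          have : θ P / L = Real.exp (n * δ) * (1 / L + w P) := by
            simp only [hθ]; field_simp
          rw [this]
          have := hw0 P
          gcongr
          exact card_typicalOutputs_le (outputDist_mem_stdSimplex hW hP) n δ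
      _ ≤ Real.exp (n * (entropy (outputDist P W) + δ)) *
          (Real.exp (n * δ) * (2 * Real.exp (-(n * K)) + w P)) := by gcongr
      _ = 2 * Real.exp (n * (entropy (outputDist P W) - K + 2 * δ))
          + Real.exp (n * (entropy (outputDist P W) - h P + 3 * δ)) := by
          have e1 : Real.exp (n * (entropy (outputDist P W) - K + 2 * δ))
              = Real.exp (n * (entropy (outputDist P W) + δ)) * Real.exp (n * δ)
                * Real.exp (-(n * K)) := by
            rw [← Real.exp_add, ← Real.exp_add]; congr 1; ring
          have e2 : Real.exp (n * (entropy (outputDist P W) - h P + 3 * δ))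
              = Real.exp (n * (entropy (outputDist P W) + δ)) * Real.exp (n * δ) * w P := by
            rw [hw, ← Real.exp_add, ← Real.exp_add]; congr 1; ring
          rw [e1, e2]; ring
      _ ≤ 2 * Real.exp (n * (C + 3 * δ)) + Real.exp (n * (C + 3 * δ)) := by
          gcongr
          linarith
      _ = _ := by ring
  have hmsg : ∀ m, (1 + L * w (empirical (c m))) / θ (empirical (c m))
      + ∑ y, channelLaw W (c m) y * (φ₁ m y + φ₂ m y)
      ≤ Real.exp (n * (-δ)) + 8 * Fintype.card Y / δ ^ 2 / n := by
    intro m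
    have e1 : (1 + L * w (empirical (c m))) / θ (empirical (c m)) = Real.exp (n * (-δ)) := by
      simp only [hθ]
      rw [mul_neg, Real.exp_neg]
      have := (hw1 (empirical (c m))).ne'
      field_simp
    have e2 := sum_not_mem_typicalOutputs_le hW hn hδ (c m) (φ₁ m)
      (fun y => by simp only [hφ₁]; split_ifs <;> simp) fun y hy => (if_pos hy).le
    have e3 := sum_channelLaw_large_le hW hn hδ (c m) (φ₂ m)
      (fun y => by simp only [hφ₂]; split_ifs <;> simp) fun y hy => (if_pos hy).le
    rw [e1]
    simp_rw [mul_add, Finset.sum_add_distrib]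
    have e4 : 8 * (Fintype.card Y : ℝ) / δ ^ 2 / n
        = 4 * Fintype.card Y / δ ^ 2 / n + 4 * Fintype.card Y / δ ^ 2 / n := by ring
    rw [e4]
    linarith
  refine key.trans ?_
  rw [mul_add]
  refine add_le_add ?_ ?_
  · have hMinv : 1 / (M : ℝ) ≤ 2 * Real.exp (-(n * R)) := by
      rw [Real.exp_neg, div_le_iff₀ hM', mul_assoc, ← div_eq_inv_mul, ← mul_div_assoc,
        le_div_iff₀ (Real.exp_pos _)]
      linarith
    calc _ ≤ (2 * Real.exp (-(n * R))) * (∑ P ∈ F, 3 * Real.exp (n * (C + 3 * δ))) :=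
          mul_le_mul hMinv (Finset.sum_le_sum hclass)
            (Finset.sum_nonneg fun P _ => by have := hθ0 P; positivity) (by positivity)
      _ ≤ (2 * Real.exp (-(n * R))) *
          (((n : ℝ) + 1) ^ Fintype.card X * (3 * Real.exp (n * (C + 3 * δ)))) := by
          rw [Finset.sum_const, nsmul_eq_mul]
          gcongr
      _ = _ := by
          have : Real.exp (n * (C + 3 * δ - R))
              = Real.exp (n * (C + 3 * δ)) * Real.exp (-(n * R)) := by
            rw [← Real.exp_add]; congr 1; ring
          rw [this]; ring
  · refine (mul_le_mul_of_nonneg_left (Finset.sum_le_sum fun m _ => hmsg m)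
      (by positivity)).trans (le_of_eq ?_)
    simp only [Finset.sum_const, Finset.card_univ, Fintype.card_fin, nsmul_eq_mul]
    field_simp

theorem le_of_mem_achievableRates [Nonempty X] {W : X → Y → ℝ} (hW : IsTransition W) {K R : ℝ}
    (hK : 0 ≤ K) (h : R ∈ achievableRates W K) :
    R ≤ max (shannonCapacity W) (maxOutputEntropy W - K) := by
  obtain ⟨hR, c, hc⟩ := h
  set C := max (shannonCapacity W) (maxOutputEntropy W - K) with hC
  by_contra! hlt
  -- A quarter of the gap makes the exponent `C + 3δ - R` equal to `-δ`; the success bound then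
  -- tends to `0` while success tends to `1`.
  set δ := (R - C) / 4 with hδdef
  have hδ : 0 < δ := by rw [hδdef]; linarith
  have hexp : C + 3 * δ - R = -δ := by rw [hδdef]; ring
  have hlim : Filter.Tendsto (fun n : ℕ =>
      6 * (((n : ℝ) + 1) ^ Fintype.card X * Real.exp (n * (-δ)))
        + (Real.exp (n * (-δ)) + 8 * Fintype.card Y / δ ^ 2 / n)) Filter.atTop (nhds 0) := by
    simpa using ((tendsto_succ_pow_mul_exp_neg (Fintype.card X) hδ).const_mul 6).add
      ((tendsto_exp_nat_mul_of_neg (neg_lt_zero.2 hδ)).add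
        (tendsto_const_div_atTop_nhds_zero_nat (8 * Fintype.card Y / δ ^ 2)))
  have hle := le_of_tendsto_of_tendsto (hc.const_sub 1) hlim (by
    filter_upwards [Filter.eventually_gt_atTop 0] with n hn
    have h := one_sub_avgError_le_of_size hW hδ (le_max_left _ _) (le_max_right _ _) hn
      (floor_exp_pos hR n) (floor_exp_pos hK n) (exp_div_two_le_floor (by positivity))
      (exp_div_two_le_floor (by positivity)) (c n)
    rwa [← hC, hexp] at h)
  linarith

-- At rate zero there is a single message, so always accepting it makes no error. This gives
-- nonemptiness and disposes of negative rates in the supremum.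
omit [Fintype X] in
theorem zero_mem_achievableRates [Nonempty X] {W : X → Y → ℝ} (hW : IsTransition W) {K : ℝ}
    (hK : 0 ≤ K) : 0 ∈ achievableRates W K := by
  refine mem_achievableRates_of_bound hW le_rfl (b := fun _ => 0) tendsto_const_nhds
    fun n _ => ⟨fun _ _ => Classical.arbitrary X, ?_⟩
  have hM1 : ⌊Real.exp ((n : ℝ) * 0)⌋₊ = 1 := by simp
  refine Finset.sum_nonpos fun ω _ => mul_nonpos_of_nonneg_of_nonpos (instanceProb_nonneg hW _ ω) ?_
  have h := instanceError_le (by rw [hM1]; exact one_pos) (floor_exp_pos hK n) ω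
    (fun _ _ => 1) fun _ _ => Or.inr rfl
  refine h.trans (le_of_eq ?_)
  have he : ∀ m : Fin ⌊Real.exp ((n : ℝ) * 0)⌋₊, Finset.univ.erase m = ∅ := by
    intro m
    rw [← Finset.card_eq_zero, Finset.card_erase_of_mem (Finset.mem_univ m)]
    simp
  simp [he]

theorem isLUB_achievableRates [Nonempty X] {W : X → Y → ℝ} (hW : IsTransition W) {K : ℝ}
    (hK : 0 ≤ K) :
    IsLUB (achievableRates W K) (max (shannonCapacity W) (maxOutputEntropy W - K)) := by
  refine ⟨fun R hR => le_of_mem_achievableRates hW hK hR, fun b hb => ?_⟩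
  have hb0 : 0 ≤ b := hb (zero_mem_achievableRates hW hK)
  refine le_of_forall_lt_imp_le_of_dense fun R hR => ?_
  rcases le_total R 0 with hR0 | hR0
  · exact hR0.trans hb0
  refine hb ?_
  rcases lt_max_iff.1 hR with hR' | hR'
  · obtain ⟨P, hP, hPeq⟩ := (isGreatest_shannonCapacity hW).1
    exact mem_achievableRates_of_lt_mutualInfo hW hP hK hR0 (hR'.trans_eq hPeq.symm)
  · obtain ⟨P, hP, hPeq⟩ := (isGreatest_maxOutputEntropy W).1
    refine mem_achievableRates_of_lt_entropy hW hP hK hR0 ?_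
    rw [← hPeq] at hR'
    exact hR'

end Converse

end CloudChannel

end

theorem theorem3 {X Y : Type*} [Fintype X] [Nonempty X] [Fintype Y] [DecidableEq Y]
    (W : X → Y → ℝ) (hW : CloudChannel.IsTransition W) (K : ℝ) (hK : 0 < K) :
    IsLUB (CloudChannel.achievableRates W K) (CloudChannel.ensembleCapacity W K) ∧
    CloudChannel.ensembleCapacity W K =
      max (CloudChannel.shannonCapacity W) (CloudChannel.maxOutputEntropy W - K) := by
  have h := CloudChannel.isLUB_achievableRates hW hK.le
  have heq : CloudChannel.ensembleCapacity W K =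
      max (CloudChannel.shannonCapacity W) (CloudChannel.maxOutputEntropy W - K) :=
    h.csSup_eq ⟨0, CloudChannel.zero_mem_achievableRates hW hK.le⟩
  exact ⟨heq ▸ h, heq⟩
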